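/- Let $n\ge 2$. A real square matrix $M=(m_{\alpha\beta})$ with rows and columns indexed by a finite set $I$ is called sign-symmetric with respect to a subset $\mathcal S\subseteq I$ if $m_{\alpha\beta}\le 0$ whenever exactly one of $\alpha,\beta$ belongs to $\mathcal S$, and $m_{\alpha\beta}<0$ only if exactly one of $\alpha,\beta$ belongs to $\mathcal S$. Let $\mathbf A=(a_{ij})$ be a real $n\times n$ matrix, and let $\mathbf A^{(2)}$ be its second compound matrix: its rows and columns are indexed by the pairs $(i,j)$ with $1\le i<j\le n$ (taken in lexicographic order), and its entry in row $(i,j)$ and column $(k,l)$ is the minor $a_{ik}a_{jl}-a_{il}a_{jk}$. Suppose that $\mathbf A$ is sign-symmetric with respect to some set $\mathcal J\subseteq\{1,\dots,n\}$, and that $\mathbf A^{(2)}$ is sign-symmetric with respect to some set $\widetilde{\mathcal J}$ of pairs $(i,j)$, $i<j$. Let $\widehat W(\mathcal J,\widetilde{\mathcal J})\subseteq\{1,\dots,n\}\times\{1,\dots,n\}$ be the set which contains all the diagonal pairs $(i,i)$ and, for $i\ne j$, contains $(i,j)$ if and only if one of the following holds: (a) $i<j$, the indices $i,j$ both belong to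 $\mathcal J$ or both do not, and $(i,j)\in\widetilde{\mathcal J}$; (b) $i<j$, exactly one of $i,j$ belongs to $\mathcal J$, and $(i,j)\notin\widetilde{\mathcal J}$; (c) $i>j$, the indices $i,j$ both belong to $\mathcal J$ or both do not, and $(j,i)\notin\widetilde{\mathcal J}$; (d) $i>j$, exactly one of $i,j$ belongs to $\mathcal J$, and $(j,i)\in\widetilde{\mathcal J}$. Suppose that $\widehat W(\mathcal J,\widetilde{\mathcal J})$ is transitive, i.e. that the relation "$(i,j)\in\widehat W(\mathcal J,\widetilde{\mathcal J})$" is a linear order on $\{1,\dots,n\}$ (reflexive, antisymmetric, transitive and connected). Then the two largest in modulus eigenvalues of $\mathbf A$ are nonnegative: the complex eigenvalues of $\mathbf A$, repeated according to algebraic multiplicity, can be enumerated as $\lambda_1,\lambda_2,\dots,\lambda_n$ so that $|\lambda_1|\ge|\lambda_2|\ge\dots\ge|\lambda_n|$ and $\lambda_1,\lambda_2$ are real and nonnegative. -/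

import Mathlib

/-- The real square matrix `A` is sign-symmetric with respect to the index set `J`: an entry whose
row and column indices are separated by `J` (one lies in `J`, the other does not) is nonpositive,
and an entry is negative only if its row and column indices are separated by `J`. -/
def IsSignSymmetricWith {ι : Type*} (A : Matrix ι ι ℝ) (J : Set ι) : Prop :=
  (∀ i j, Xor (i ∈ J) (j ∈ J) → A i j ≤ 0) ∧ (∀ i j, A i j < 0 → Xor (i ∈ J) (j ∈ J))

/-- The pairs `(i, j)` of indices with `i < j`, which number the rows and columns of the second
compound matrix. -/
abbrev IncreasingPair (n : ℕ) : Type := {p : Fin n × Fin n // p.1 < p.2}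

/-- The second compound matrix of `A`: its entry at `((i, j), (k, l))`, `i < j`, `k < l`, is the
minor `A i k * A j l - A i l * A j k` of `A` formed by the rows `i, j` and the columns `k, l`. -/
noncomputable def secondCompound {n : ℕ} (A : Matrix (Fin n) (Fin n) ℝ) :
    Matrix (IncreasingPair n) (IncreasingPair n) ℝ :=
  Matrix.of fun p q => A p.1.1 q.1.1 * A p.1.2 q.1.2 - A p.1.1 q.1.2 * A p.1.2 q.1.1

/-- The set `Ŵ(J, J')` of pairs of indices. The diagonal pairs always belong to it; the four other
cases distinguish the order of `i, j` and whether `i, j` are separated by `J`. -/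
def wHat {n : ℕ} (J : Set (Fin n)) (J' : Set (IncreasingPair n)) : Set (Fin n × Fin n) :=
  {p | p.1 = p.2 ∨
    (∃ h : p.1 < p.2, (p.1 ∈ J ↔ p.2 ∈ J) ∧ (⟨(p.1, p.2), h⟩ : IncreasingPair n) ∈ J') ∨
    (∃ h : p.1 < p.2, Xor (p.1 ∈ J) (p.2 ∈ J) ∧ (⟨(p.1, p.2), h⟩ : IncreasingPair n) ∉ J') ∨
    (∃ h : p.2 < p.1, (p.1 ∈ J ↔ p.2 ∈ J) ∧ (⟨(p.2, p.1), h⟩ : IncreasingPair n) ∉ J') ∨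
    (∃ h : p.2 < p.1, Xor (p.1 ∈ J) (p.2 ∈ J) ∧ (⟨(p.2, p.1), h⟩ : IncreasingPair n) ∈ J')}

/-- A set `W` of pairs is transitive if the relation `(i, j) ∈ W` is a (reflexive) linear order. -/
structure IsTransitiveSet {n : ℕ} (W : Set (Fin n × Fin n)) : Prop where
  union_swap : W ∪ {p | (p.2, p.1) ∈ W} = Set.univ
  inter_swap : W ∩ {p | (p.2, p.1) ∈ W} = {p | p.1 = p.2}
  trans : ∀ i j k, (i, j) ∈ W → (j, k) ∈ W → (i, k) ∈ W

/-- The multiset of complex eigenvalues of a real matrix, repeated according to algebraic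
multiplicity. -/
noncomputable def complexEigenvalues {n : ℕ} (A : Matrix (Fin n) (Fin n) ℝ) : Multiset ℂ :=
  (A.map Complex.ofReal).charpoly.roots

/-! Conjugation by the diagonal `±1` matrix of `J` keeps the spectrum of `A` and makes its entries
nonnegative. The sign pattern of the compound matrix, read through `wHat`, says that the order-two
minors of the conjugate `B` are nonnegative once the indices are arranged by the given linear order.
A Perron argument then applies twice. Nonnegative power sums force the largest modulus to occur in
the family itself (`exists_eq_norm_of_powerSum_nonneg`). The traces of `B ^ k` give this for the
eigenvalues; the differences `(tr B ^ k) ^ 2 - tr B ^ (2 * k)`, nonnegative by Cauchy–Binet, give it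
for the products of two eigenvalues, so the spectrum of the compound is never needed. To deduce the
sign of the second eigenvalue, the first must be the only value on its circle, which a positive
diagonal ensures. The general case follows by approximating `B` with `F * B * F`, where `F` is
positive with nonnegative order-two minors and tends to the identity, and by compactness of the
eigenvalue lists. -/

open Filter Topology

/-! ### Traces of powers as power sums of eigenvalues -/

open Polynomial in
/-- If the characteristic polynomial of `M` has the roots `z i`, then `det (p(M)) = ∏ p(z i)`. -/
theorem det_aeval_of_charpoly_eq_prod {ι κ : Type*} [Fintype ι] [DecidableEq ι] [Fintype κ]
    {M : Matrix ι ι ℂ} {z : κ → ℂ} (hM : M.charpoly = ∏ i, (X - C (z i))) (p : ℂ[X]) :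
    (aeval M p).det = ∏ i, p.eval (z i) := by
  have hcard : Fintype.card ι = Fintype.card κ := by
    have h := congrArg natDegree hM
    rw [Matrix.charpoly_natDegree_eq_dim, natDegree_prod_of_monic _ _ fun i _ => monic_X_sub_C _] at h
    simpa using h
  -- Both sides are multiplicative in `p`, so constants and the factors `X + C a` suffice.
  have hp : p.Splits := IsAlgClosed.splits p
  induction hp using Submonoid.closure_induction with
  | mem q hq =>
    rcases hq with ⟨a, rfl⟩ | ⟨a, rfl⟩
    · simp [Algebra.algebraMap_eq_smul_one, hcard]
    · have h := congrArg (eval (-a)) hM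
      rw [Matrix.eval_charpoly, eval_prod] at h
      have e1 : Matrix.scalar ι (-a) - M = -(aeval M (X + C a)) := by
        simp [Matrix.algebraMap_eq_diagonal, ← Matrix.diagonal_neg, sub_eq_add_neg, add_comm]
      have e2 : ∀ i, eval (-a) (X - C (z i)) = -1 * eval (z i) (X + C a) := by
        intro i; simp; ring
      rw [e1, Matrix.det_neg, hcard] at h
      simp only [e2, Finset.prod_mul_distrib, Finset.prod_const, Finset.card_univ] at h
      exact mul_left_cancel₀ (pow_ne_zero _ (by norm_num)) h
  | one => simp
  | mul p q _ _ hp hq => simp [hp, hq, Finset.prod_mul_distrib]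

open Polynomial in
theorem roots_prod_X_sub_C_family {κ : Type*} [Fintype κ] (z : κ → ℂ) :
    (∏ i, (X - C (z i))).roots = Finset.univ.val.map z := by
  rw [Finset.prod_eq_multiset_prod, ← roots_multiset_prod_X_sub_C (Finset.univ.val.map z),
    Multiset.map_map]
  rfl

open Polynomial in
/-- The trace of `M ^ k` is the power sum of the roots of the characteristic polynomial of `M`. -/
theorem trace_pow_of_charpoly_eq_prod {ι κ : Type*} [Fintype ι] [DecidableEq ι] [Fintype κ]
    {M : Matrix ι ι ℂ} {z : κ → ℂ} (hM : M.charpoly = ∏ i, (X - C (z i))) (k : ℕ) :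
    (M ^ k).trace = ∑ i, z i ^ k := by
  have h : (M ^ k).charpoly = ∏ i, (X - C (z i ^ k)) := by
    refine Polynomial.funext fun w => ?_
    have h1 := det_aeval_of_charpoly_eq_prod hM (C w - X ^ k)
    rw [Matrix.eval_charpoly, eval_prod]
    simpa [Matrix.algebraMap_eq_diagonal, Pi.algebraMap_def] using h1
  rw [Matrix.trace_eq_sum_roots_charpoly, h, roots_prod_X_sub_C_family]
  rfl

open Polynomial in
theorem exists_charpoly_eq_prod {m : ℕ} (M : Matrix (Fin m) (Fin m) ℂ) :
    ∃ z : Fin m → ℂ, M.charpoly = ∏ i, (X - C (z i)) := by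
  obtain ⟨l, hl⟩ := Quot.exists_rep M.charpoly.roots
  have hsplit : M.charpoly.Splits := IsAlgClosed.splits _
  have hlen : l.length = m := by
    have h1 := hsplit.natDegree_eq_card_roots
    rw [Matrix.charpoly_natDegree_eq_dim, ← hl] at h1
    simpa using h1.symm
  subst hlen
  refine ⟨fun i => l[i], ?_⟩
  rw [hsplit.eq_prod_roots_of_monic M.charpoly_monic, ← hl]
  simp
  exact (Fin.prod_univ_fun_getElem l fun x => X - C x).symm

/-! ### Families with nonnegative power sums -/

/-- The factor `1 - x` isolates a pole at `x = 1`; summed over a family, the limit counts the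
members equal to `1`. -/
theorem tendsto_one_sub_div_one_sub_mul (u : ℂ) :
    Tendsto (fun x : ℝ => (1 - (x : ℂ)) * (1 - x * u)⁻¹) (𝓝[<] 1) (𝓝 (if u = 1 then 1 else 0)) := by
  split_ifs with h
  · subst h
    refine tendsto_const_nhds.congr' ?_
    filter_upwards [self_mem_nhdsWithin] with x hx
    have : (1 - (x : ℂ)) ≠ 0 := by
      rw [sub_ne_zero]; exact_mod_cast (ne_of_lt hx).symm
    simp [this]
  · have hu : (1 : ℂ) - (1 : ℝ) * u ≠ 0 := by
      simpa [sub_eq_zero] using Ne.symm h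
    have : ContinuousAt (fun x : ℝ => (1 - (x : ℂ)) * (1 - x * u)⁻¹) 1 := by
      refine ContinuousAt.mul (by fun_prop) (ContinuousAt.inv₀ (by fun_prop) hu)
    have h2 := this.tendsto.mono_left (nhdsWithin_le_nhds (s := Set.Iio 1))
    simpa using h2

theorem hasSum_powerSum_mul_pow {ι : Type*} (s : Finset ι) (u : ι → ℂ) (hu : ∀ i ∈ s, ‖u i‖ ≤ 1)
    {w : ℂ} (hw : ‖w‖ ≤ 1) {x : ℝ} (hx0 : 0 ≤ x) (hx1 : x < 1) :
    HasSum (fun k : ℕ => (∑ i ∈ s, u i ^ k) * w ^ k * (x : ℂ) ^ k)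
      (∑ i ∈ s, (1 - x * (w * u i))⁻¹) := by
  have h : ∀ i ∈ s, HasSum (fun k : ℕ => ((x : ℂ) * (w * u i)) ^ k) (1 - x * (w * u i))⁻¹ := by
    intro i hi
    refine hasSum_geometric_of_norm_lt_one ?_
    rw [norm_mul, norm_mul, Complex.norm_real, Real.norm_of_nonneg hx0]
    have := mul_le_one₀ hw (norm_nonneg _) (hu i hi)
    nlinarith
  convert hasSum_sum h using 2 with k
  rw [Finset.sum_mul, Finset.sum_mul]
  exact Finset.sum_congr rfl fun i _ => by ring

/-- A finite family of complex numbers whose power sums are all nonnegative contains its largest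
modulus. -/
theorem exists_eq_norm_of_powerSum_nonneg {ι : Type*} (s : Finset ι) (z : ι → ℂ)
    (h : ∀ k : ℕ, ∃ r : ℝ, 0 ≤ r ∧ ∑ i ∈ s, z i ^ k = r) {i₀ : ι} (hi₀ : i₀ ∈ s)
    (hmax : ∀ i ∈ s, ‖z i‖ ≤ ‖z i₀‖) : ∃ i ∈ s, z i = ‖z i₀‖ := by
  rcases (norm_nonneg (z i₀)).eq_or_lt with h0 | hR
  · exact ⟨i₀, hi₀, by rw [← h0]; simpa using h0.symm⟩
  set R := ‖z i₀‖ with hRdef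
  have hRC : (R : ℂ) ≠ 0 := by exact_mod_cast hR.ne'
  by_contra! hno
  set u : ι → ℂ := fun i => z i / R with hu
  have hu1 : ∀ i ∈ s, ‖u i‖ ≤ 1 := by
    intro i hi
    rw [hu, norm_div, Complex.norm_real, Real.norm_of_nonneg hR.le]
    exact (div_le_one hR).2 (hmax i hi)
  have hune : ∀ i ∈ s, u i ≠ 1 := by
    intro i hi he
    exact hno i hi (by rwa [hu, div_eq_one_iff_eq hRC] at he)
  have hp : ∀ k : ℕ, ∃ r : ℝ, 0 ≤ r ∧ ∑ i ∈ s, u i ^ k = r := by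
    intro k
    obtain ⟨r, hr, he⟩ := h k
    refine ⟨r / R ^ k, by positivity, ?_⟩
    simp only [hu, div_pow, ← Finset.sum_div, he]
    push_cast; rfl
  choose p hp0 hp1 using hp
  -- With this twist the generating function has a pole at `x = 1` coming from `i₀`; untwisted, it
  -- has none if no `u i` equals `1`.
  set w : ℂ := (u i₀)⁻¹ with hw
  have hn0 : ‖u i₀‖ = 1 := by
    rw [hu, norm_div, Complex.norm_real, Real.norm_of_nonneg hR.le, ← hRdef, div_self hR.ne']
  have hw1 : ‖w‖ = 1 := by rw [hw, norm_inv, hn0, inv_one]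
  have hu0 : u i₀ ≠ 0 := by intro h; simp [h] at hn0
  -- Since the coefficients `p k` are nonnegative and `‖w‖ = 1`, the untwisted series dominates the
  -- twisted one.
  have key : ∀ x : ℝ, 0 ≤ x → x < 1 →
      ‖∑ i ∈ s, (1 - (x : ℂ)) * (1 - x * (w * u i))⁻¹‖ ≤
        ‖∑ i ∈ s, (1 - (x : ℂ)) * (1 - x * (1 * u i))⁻¹‖ := by
    intro x hx0 hx1
    have hs1 := hasSum_powerSum_mul_pow s u hu1 (w := w) hw1.le hx0 hx1
    have hs2 := hasSum_powerSum_mul_pow s u hu1 (w := 1) (by simp) hx0 hx1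
    rw [← Finset.mul_sum, ← Finset.mul_sum, norm_mul, norm_mul]
    refine mul_le_mul_of_nonneg_left ?_ (norm_nonneg _)
    simp only [hp1, one_pow, mul_one] at hs1 hs2
    have hs3 : HasSum (fun k : ℕ => p k * x ^ k) (∑ i ∈ s, (1 - x * (1 * u i))⁻¹).re := by
      have := Complex.hasSum_re hs2
      simpa only [← Complex.ofReal_pow, ← Complex.ofReal_mul, Complex.ofReal_re] using this
    refine le_trans ?_ (Complex.re_le_norm _)
    rw [← hs1.tsum_eq, ← hs3.tsum_eq]
    refine tsum_of_norm_bounded hs3.summable.hasSum fun k => ?_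
    rw [norm_mul, norm_mul, norm_pow, norm_pow, hw1, Complex.norm_real, Complex.norm_real,
      Real.norm_of_nonneg (hp0 k), Real.norm_of_nonneg hx0]
    simp
  have hlim : ∀ v : ℂ, Tendsto (fun x : ℝ => ‖∑ i ∈ s, (1 - (x : ℂ)) * (1 - x * (v * u i))⁻¹‖)
      (𝓝[<] 1) (𝓝 ‖∑ i ∈ s, if v * u i = 1 then (1 : ℂ) else 0‖) := fun v =>
    (tendsto_finsetSum _ fun i _ => tendsto_one_sub_div_one_sub_mul (v * u i)).norm
  have hle := le_of_tendsto_of_tendsto (hlim w) (hlim 1) (by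
    filter_upwards [Ioo_mem_nhdsLT (show (0 : ℝ) < 1 by norm_num)] with x hx
    exact key x hx.1.le hx.2)
  have hz : ∑ i ∈ s, (if 1 * u i = 1 then (1 : ℂ) else 0) = 0 :=
    Finset.sum_eq_zero fun i hi => by simp [hune i hi]
  rw [hz, norm_zero, norm_le_zero_iff, Finset.sum_boole, Nat.cast_eq_zero,
    Finset.card_eq_zero] at hle
  have : i₀ ∈ s.filter fun i => w * u i = 1 := by
    simp [hi₀, hw, hu0]
  simp [hle] at this

/-! ### Perron eigenvalues of nonnegative matrices -/

theorem Matrix.mul_nonneg_entries {ι : Type*} [Fintype ι] {A B : Matrix ι ι ℝ}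
    (hA : ∀ i j, 0 ≤ A i j) (hB : ∀ i j, 0 ≤ B i j) (i j : ι) : 0 ≤ (A * B) i j :=
  Finset.sum_nonneg fun p _ => mul_nonneg (hA i p) (hB p j)

theorem Matrix.pow_nonneg_entries {ι : Type*} [Fintype ι] [DecidableEq ι] {A : Matrix ι ι ℝ}
    (hA : ∀ i j, 0 ≤ A i j) (k : ℕ) : ∀ i j, 0 ≤ (A ^ k) i j := by
  induction k with
  | zero => intro i j; rw [pow_zero, Matrix.one_apply]; split_ifs <;> norm_num
  | succ k ih => rw [pow_succ]; exact Matrix.mul_nonneg_entries ih hA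

theorem sum_pow_eq_ofReal_trace {ι κ : Type*} [Fintype ι] [DecidableEq ι] [Fintype κ]
    {B : Matrix ι ι ℝ} {z : κ → ℂ}
    (hz : (B.map Complex.ofReal).charpoly = ∏ i, (Polynomial.X - Polynomial.C (z i))) (k : ℕ) :
    ∑ i, z i ^ k = ((B ^ k).trace : ℂ) := by
  rw [← trace_pow_of_charpoly_eq_prod hz]
  have h : (B.map Complex.ofReal) ^ k = (B ^ k).map Complex.ofReal :=
    (map_pow (Complex.ofRealHom.mapMatrix) B k).symm
  rw [h]
  simp [Matrix.trace]

/-- The largest modulus of the eigenvalues of an entrywise nonnegative matrix is an eigenvalue. -/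
theorem exists_eq_norm_of_nonneg {ι κ : Type*} [Fintype ι] [DecidableEq ι] [Fintype κ]
    {B : Matrix ι ι ℝ} (hB : ∀ i j, 0 ≤ B i j) {z : κ → ℂ}
    (hz : (B.map Complex.ofReal).charpoly = ∏ i, (Polynomial.X - Polynomial.C (z i)))
    {i₀ : κ} (hmax : ∀ i, ‖z i‖ ≤ ‖z i₀‖) : ∃ i, z i = ‖z i₀‖ := by
  obtain ⟨i, -, hi⟩ := exists_eq_norm_of_powerSum_nonneg Finset.univ z
    (fun k => ⟨(B ^ k).trace, Finset.sum_nonneg fun i _ => Matrix.pow_nonneg_entries hB k i i,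
      sum_pow_eq_ofReal_trace hz k⟩) (Finset.mem_univ i₀) fun i _ => hmax i
  exact ⟨i, hi⟩

/-- A nonnegative matrix with positive diagonal has a single eigenvalue of largest modulus. -/
theorem eq_norm_of_nonneg_of_pos_diag {ι κ : Type*} [Fintype ι] [DecidableEq ι] [Fintype κ]
    {B : Matrix ι ι ℝ} (hB : ∀ i j, 0 ≤ B i j) (hd : ∀ i, 0 < B i i) {z : κ → ℂ}
    (hz : (B.map Complex.ofReal).charpoly = ∏ i, (Polynomial.X - Polynomial.C (z i)))
    {i₀ : κ} (hmax : ∀ i, ‖z i‖ ≤ ‖z i₀‖) : z i₀ = ‖z i₀‖ := by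
  obtain ⟨c, hc, hcB⟩ : ∃ c : ℝ, 0 < c ∧ ∀ i, c ≤ B i i := by
    rcases isEmpty_or_nonempty ι with h | h
    · exact ⟨1, one_pos, fun i => h.elim i⟩
    · obtain ⟨i, hi⟩ := Finite.exists_min fun i => B i i
      exact ⟨B i i, hd i, hi⟩
  have hz' : ((B - Matrix.scalar ι c).map Complex.ofReal).charpoly =
      ∏ i, (Polynomial.X - Polynomial.C (z i - c)) := by
    have h1 : (B - Matrix.scalar ι c).map Complex.ofReal =
        B.map Complex.ofReal - Matrix.scalar ι (c : ℂ) := by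
      ext i j
      by_cases hij : i = j <;> simp [hij]
    rw [h1, Matrix.charpoly_sub_scalar, hz, Polynomial.prod_comp]
    refine Finset.prod_congr rfl fun i _ => ?_
    simp only [Polynomial.sub_comp, Polynomial.X_comp, Polynomial.C_comp, map_sub]
    ring
  have hB' : ∀ i j, 0 ≤ (B - Matrix.scalar ι c) i j := by
    intro i j
    by_cases hij : i = j
    · subst hij; simpa using hcB i
    · simpa [Matrix.diagonal_apply, hij] using hB i j
  have : Nonempty κ := ⟨i₀⟩
  obtain ⟨j, hj⟩ := Finite.exists_max fun i => ‖z i - c‖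
  obtain ⟨k, hk⟩ := exists_eq_norm_of_nonneg hB' hz' hj
  have h1 : z k = ((‖z j - c‖ + c : ℝ) : ℂ) := by
    push_cast; rw [← hk]; ring
  have h2 := hmax k
  rw [h1, Complex.norm_real, Real.norm_of_nonneg (by positivity)] at h2
  -- The shifted matrix is still nonnegative, so its spectral radius plus `c` is an eigenvalue of
  -- `B`, hence at most `‖z i₀‖`. This is equality in the triangle inequality, so `z i₀ - c` lies on
  -- the ray of `c`.
  have h3 : ‖z i₀ - c‖ + ‖(c : ℂ)‖ = ‖(z i₀ - c) + c‖ := by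
    refine le_antisymm ?_ (norm_add_le _ _)
    rw [sub_add_cancel, Complex.norm_real, Real.norm_of_nonneg hc.le]
    linarith [hj i₀]
  have h4 : SameRay ℝ (z i₀ - c) (c : ℂ) := sameRay_iff_norm_add.2 h3.symm
  obtain ⟨r, hr, hre⟩ := h4.symm.exists_nonneg_left (by exact_mod_cast hc.ne')
  have h5 : z i₀ = ((r * c + c : ℝ) : ℂ) := by
    have : z i₀ - c = (r : ℂ) * c := by rw [← hre]; simp
    push_cast
    rw [← this]; ring
  rw [h5, Complex.norm_real, Real.norm_of_nonneg (by positivity)]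

/-! ### Nonnegative minors of order two -/

/-- With the indices ordered by `e`, all minors of order two of `B` are nonnegative. -/
def HasNonnegMinorsTwo {ι : Type*} (e : ι → ℕ) (B : Matrix ι ι ℝ) : Prop :=
  ∀ i j k l, e i < e j → e k < e l → B i l * B j k ≤ B i k * B j l

/-- Cauchy–Binet: antisymmetrizing the double sum in `p, q` turns each term into a product of two
minors, whose signs agree. -/
theorem HasNonnegMinorsTwo.mul {ι : Type*} [Fintype ι] {e : ι → ℕ} (he : Function.Injective e)
    {A B : Matrix ι ι ℝ} (hA : HasNonnegMinorsTwo e A) (hB : HasNonnegMinorsTwo e B) :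
    HasNonnegMinorsTwo e (A * B) := by
  intro i j k l hij hkl
  have h1 : (A * B) i k * (A * B) j l - (A * B) i l * (A * B) j k =
      ∑ p, ∑ q, A i p * A j q * (B p k * B q l - B p l * B q k) := by
    simp only [Matrix.mul_apply, Finset.sum_mul_sum, ← Finset.sum_sub_distrib]
    exact Finset.sum_congr rfl fun p _ => Finset.sum_congr rfl fun q _ => by ring
  have h2 : ∑ p, ∑ q, A i p * A j q * (B p k * B q l - B p l * B q k) =
      -∑ p, ∑ q, A i q * A j p * (B p k * B q l - B p l * B q k) := by
    rw [Finset.sum_comm, ← Finset.sum_neg_distrib]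
    refine Finset.sum_congr rfl fun p _ => ?_
    rw [← Finset.sum_neg_distrib]
    exact Finset.sum_congr rfl fun q _ => by ring
  have h3 : 0 ≤ ∑ p, ∑ q, (A i p * A j q - A i q * A j p) * (B p k * B q l - B p l * B q k) := by
    refine Finset.sum_nonneg fun p _ => Finset.sum_nonneg fun q _ => ?_
    rcases lt_trichotomy (e p) (e q) with h | h | h
    · exact mul_nonneg (sub_nonneg.2 (hA i j p q hij h)) (sub_nonneg.2 (by
        linarith [hB p q k l h hkl]))
    · rw [he h]; simp
    · exact mul_nonneg_of_nonpos_of_nonpos (sub_nonpos.2 (hA i j q p hij h)) (sub_nonpos.2 (by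
        linarith [hB q p k l h hkl]))
  simp only [sub_mul (A i _ * A j _), Finset.sum_sub_distrib] at h3
  linarith

theorem HasNonnegMinorsTwo.one {ι : Type*} [DecidableEq ι] (e : ι → ℕ) :
    HasNonnegMinorsTwo e (1 : Matrix ι ι ℝ) := by
  intro i j k l hij hkl
  have h : (1 : Matrix ι ι ℝ) i l * (1 : Matrix ι ι ℝ) j k = 0 := by
    by_contra hne
    have h1 : i = l := by by_contra h; simp [Matrix.one_apply, h] at hne
    have h2 : j = k := by by_contra h; simp [Matrix.one_apply, h] at hne
    subst h1 h2
    omega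
  rw [h]
  exact mul_nonneg (by rw [Matrix.one_apply]; split_ifs <;> norm_num)
    (by rw [Matrix.one_apply]; split_ifs <;> norm_num)

theorem HasNonnegMinorsTwo.pow {ι : Type*} [Fintype ι] [DecidableEq ι] {e : ι → ℕ}
    (he : Function.Injective e) {A : Matrix ι ι ℝ} (hA : HasNonnegMinorsTwo e A) (k : ℕ) :
    HasNonnegMinorsTwo e (A ^ k) := by
  induction k with
  | zero => rw [pow_zero]; exact .one e
  | succ k ih => rw [pow_succ]; exact ih.mul he hA

/-- The difference of the two sides is twice the sum of the principal minors of order two. -/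
theorem HasNonnegMinorsTwo.trace_sq_le {ι : Type*} [Fintype ι] {e : ι → ℕ}
    (he : Function.Injective e) {A : Matrix ι ι ℝ} (hA : HasNonnegMinorsTwo e A) :
    (A * A).trace ≤ A.trace ^ 2 := by
  rw [sq, Matrix.trace, Matrix.trace, Finset.sum_mul_sum]
  refine Finset.sum_le_sum fun i _ => ?_
  rw [Matrix.diag_apply, Matrix.mul_apply]
  refine Finset.sum_le_sum fun j _ => ?_
  rw [Matrix.diag_apply, Matrix.diag_apply]
  rcases lt_trichotomy (e i) (e j) with h | h | h
  · exact hA i j i j h h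
  · rw [he h]
  · linarith [hA j i j i h h]

/-! ### The two dominant eigenvalues for a positive diagonal -/

/-- The eigenvalues of `M` can be listed as `l₁, l₂, r 0, …` with `l₁ ≥ l₂ ≥ 0` and `l₂` bounding
the moduli of the `r i`. -/
def HasDominantNonnegPair {ι : Type*} [Fintype ι] [DecidableEq ι] (m : ℕ) (M : Matrix ι ι ℂ) :
    Prop :=
  ∃ (l₁ l₂ : ℝ) (r : Fin m → ℂ), 0 ≤ l₂ ∧ l₂ ≤ l₁ ∧ (∀ i, ‖r i‖ ≤ l₂) ∧
    M.charpoly = (Polynomial.X - Polynomial.C (l₁ : ℂ)) * ((Polynomial.X - Polynomial.C (l₂ : ℂ)) *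
      ∏ i, (Polynomial.X - Polynomial.C (r i)))

theorem Equiv.Perm.exists_apply_zero_one {m : ℕ} {i₀ i₁ : Fin (m + 2)} (h : i₁ ≠ i₀) :
    ∃ σ : Equiv.Perm (Fin (m + 2)), σ 0 = i₀ ∧ σ 1 = i₁ := by
  refine ⟨(Equiv.swap 1 (Equiv.swap 0 i₀ i₁)).trans (Equiv.swap 0 i₀), ?_, ?_⟩
  · have h1 : (0 : Fin (m + 2)) ≠ Equiv.swap 0 i₀ i₁ := by
      intro h0
      have := congrArg (Equiv.swap 0 i₀) h0
      rw [Equiv.swap_apply_left, Equiv.swap_apply_self] at this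
      exact h this.symm
    rw [Equiv.trans_apply, Equiv.swap_apply_of_ne_of_ne (by simp) h1, Equiv.swap_apply_left]
  · rw [Equiv.trans_apply, Equiv.swap_apply_left, Equiv.swap_apply_self]

theorem hasDominantNonnegPair_of_indices {ι : Type*} [Fintype ι] [DecidableEq ι] {m : ℕ}
    {M : Matrix ι ι ℂ} {z : Fin (m + 2) → ℂ}
    (hz : M.charpoly = ∏ i, (Polynomial.X - Polynomial.C (z i))) {i₀ i₁ : Fin (m + 2)}
    (hne : i₁ ≠ i₀) (h0 : z i₀ = ‖z i₀‖) (h1 : z i₁ = ‖z i₁‖) (hle : ‖z i₁‖ ≤ ‖z i₀‖)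
    (hmax : ∀ i, i ≠ i₀ → ‖z i‖ ≤ ‖z i₁‖) : HasDominantNonnegPair m M := by
  obtain ⟨σ, hσ0, hσ1⟩ := Equiv.Perm.exists_apply_zero_one hne
  refine ⟨‖z i₀‖, ‖z i₁‖, fun i => z (σ i.succ.succ), norm_nonneg _, hle, fun i => ?_, ?_⟩
  · refine hmax _ fun h => ?_
    rw [← hσ0] at h
    exact Fin.succ_ne_zero _ (σ.injective h)
  · rw [hz, ← h0, ← h1, ← Equiv.prod_comp σ, Fin.prod_univ_succ, Fin.prod_univ_succ,
      Fin.succ_zero_eq_one, hσ0, hσ1]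

theorem sum_offDiag_mul_pow {κ : Type*} [Fintype κ] [DecidableEq κ] (z : κ → ℂ) (k : ℕ) :
    ∑ p ∈ (Finset.univ : Finset κ).offDiag, (z p.1 * z p.2) ^ k =
      (∑ i, z i ^ k) ^ 2 - ∑ i, z i ^ (2 * k) := by
  have h : ∑ p ∈ (Finset.univ : Finset κ) ×ˢ Finset.univ, (z p.1 * z p.2) ^ k =
      (∑ i, z i ^ k) ^ 2 := by
    rw [Finset.sum_product, sq, Finset.sum_mul_sum]
    simp only [mul_pow]
  rw [← h, ← Finset.diag_union_offDiag, Finset.sum_union (Finset.disjoint_diag_offDiag _),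
    Finset.sum_diag]
  have h2 : ∀ i, (z i * z i) ^ k = z i ^ (2 * k) := fun i => by rw [pow_mul, sq]
  simp only [h2]
  ring

theorem HasNonnegMinorsTwo.hasDominantNonnegPair_of_pos_diag {m : ℕ} {e : Fin (m + 2) → ℕ}
    (he : Function.Injective e) {B : Matrix (Fin (m + 2)) (Fin (m + 2)) ℝ}
    (hB2 : HasNonnegMinorsTwo e B) (hB : ∀ i j, 0 ≤ B i j) (hd : ∀ i, 0 < B i i) :
    HasDominantNonnegPair m (B.map Complex.ofReal) := by
  obtain ⟨z, hz⟩ := exists_charpoly_eq_prod (B.map Complex.ofReal)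
  obtain ⟨i₀, hi₀⟩ := Finite.exists_max fun i => ‖z i‖
  have hz0 := eq_norm_of_nonneg_of_pos_diag hB hd hz hi₀
  obtain ⟨i₁, hi₁, hmax⟩ := Finset.exists_max_image (Finset.univ.erase i₀) (fun i => ‖z i‖)
    (by rw [← Finset.card_pos]; simp)
  simp only [Finset.mem_erase, Finset.mem_univ, and_true] at hi₁ hmax
  suffices h : ∃ j, j ≠ i₀ ∧ z j = ‖z i₁‖ by
    obtain ⟨j, hj, hzj⟩ := h
    have hn : ‖z j‖ = ‖z i₁‖ := by rw [hzj, Complex.norm_real, norm_norm]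
    exact hasDominantNonnegPair_of_indices hz hj hz0 (by rw [hn, hzj]) (hi₀ j)
      fun i hi => by rw [hn]; exact hmax i hi
  rcases (hi₀ i₁).eq_or_lt with heq | hlt
  -- In a tie `i₁` also attains the largest modulus.
  · exact ⟨i₁, hi₁, eq_norm_of_nonneg_of_pos_diag hB hd hz fun i => (hi₀ i).trans heq.ge⟩
  rcases (norm_nonneg (z i₁)).eq_or_lt with h0 | hpos
  · exact ⟨i₁, hi₁, by rw [← h0]; simpa using h0.symm⟩
  have hρ : (‖z i₀‖ : ℂ) ≠ 0 := by exact_mod_cast (hpos.trans hlt).ne'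
  -- Among products over distinct indices, `(i₀, i₁)` has the largest modulus, so some product
  -- equals `‖z i₀‖ * ‖z i₁‖`.
  obtain ⟨p, hp, hpz⟩ := exists_eq_norm_of_powerSum_nonneg (Finset.univ.offDiag)
    (fun p : Fin (m + 2) × Fin (m + 2) => z p.1 * z p.2)
    (fun k => ⟨(B ^ k).trace ^ 2 - (B ^ k * B ^ k).trace,
      sub_nonneg.2 ((hB2.pow he k).trace_sq_le he), by
        rw [sum_offDiag_mul_pow, sum_pow_eq_ofReal_trace hz, sum_pow_eq_ofReal_trace hz, two_mul,
          pow_add]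
        push_cast; rfl⟩)
    (i₀ := (i₀, i₁)) (by simpa using hi₁.symm) (by
      rintro ⟨i, j⟩ hij
      simp only [Finset.mem_offDiag, Finset.mem_univ, true_and] at hij
      simp only [norm_mul]
      by_cases hi : i = i₀
      · rw [hi]
        exact mul_le_mul_of_nonneg_left (hmax j (by rw [← hi]; exact hij.symm)) (norm_nonneg _)
      · rw [mul_comm]
        exact mul_le_mul (hi₀ j) (hmax i hi) (norm_nonneg _) (norm_nonneg _))
  obtain ⟨i, j⟩ := p
  simp only [Finset.mem_offDiag, Finset.mem_univ, true_and] at hp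
  simp only [norm_mul, Complex.ofReal_mul] at hpz
  by_cases hi : i = i₀
  · refine ⟨j, by rw [← hi]; exact hp.symm, ?_⟩
    rw [hi, hz0] at hpz
    simp only [Complex.norm_real, norm_norm] at hpz
    exact mul_left_cancel₀ hρ hpz
  by_cases hj : j = i₀
  · refine ⟨i, hi, ?_⟩
    rw [hj, hz0, mul_comm] at hpz
    simp only [Complex.norm_real, norm_norm] at hpz
    exact mul_left_cancel₀ hρ hpz
  -- A pair avoiding `i₀` has product of modulus at most `‖z i₁‖ ^ 2`, which is strictly too small.
  exfalso
  have hn := congrArg norm hpz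
  simp only [norm_mul, Complex.norm_real, norm_norm] at hn
  have := mul_le_mul (hmax i hi) (hmax j hj) (norm_nonneg _) (norm_nonneg _)
  nlinarith

/-! ### Passage to the limit -/

theorem norm_le_of_isRoot_charpoly {ι : Type*} [Fintype ι] [DecidableEq ι] {M : Matrix ι ι ℂ}
    {K : ℝ} (hM : ∀ i j, ‖M i j‖ ≤ K) {w : ℂ} (hw : M.charpoly.IsRoot w) :
    ‖w‖ ≤ Fintype.card ι * K := by
  have hev : Module.End.HasEigenvalue (Matrix.toLin' M) w := by
    rw [Module.End.hasEigenvalue_iff_isRoot_charpoly]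
    simpa using hw
  obtain ⟨k, hk⟩ := eigenvalue_mem_ball hev
  rw [Metric.mem_closedBall, dist_eq_norm] at hk
  have h1 : ‖w‖ ≤ ‖w - M k k‖ + ‖M k k‖ := by
    simpa using norm_add_le (w - M k k) (M k k)
  calc ‖w‖ ≤ ∑ j, ‖M k j‖ := by
        rw [← Finset.sum_erase_add _ _ (Finset.mem_univ k)]; linarith
    _ ≤ ∑ _j : ι, K := Finset.sum_le_sum fun j _ => hM k j
    _ = Fintype.card ι * K := by simp

/-- Bounded entries bound the eigenvalues, so a subsequence of the lists converges; the inequalities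
and the factorization, tested pointwise, survive the limit. -/
theorem HasDominantNonnegPair.of_tendsto {ι : Type*} [Fintype ι] [DecidableEq ι] {m : ℕ}
    {M : ℕ → Matrix ι ι ℂ} {M₀ : Matrix ι ι ℂ} (hlim : Tendsto M atTop (𝓝 M₀))
    (hM : ∀ k, HasDominantNonnegPair m (M k)) : HasDominantNonnegPair m M₀ := by
  have hent : ∀ i j, Tendsto (fun k => M k i j) atTop (𝓝 (M₀ i j)) := fun i j =>
    tendsto_pi_nhds.1 (tendsto_pi_nhds.1 hlim i) j
  have hbd : ∀ i j, ∃ K, ∀ k, ‖M k i j‖ ≤ K := fun i j => by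
    obtain ⟨K, hK⟩ := (hent i j).norm.bddAbove_range
    exact ⟨K, fun k => hK ⟨k, rfl⟩⟩
  choose K hK using hbd
  have hK' : ∀ k i j, ‖M k i j‖ ≤ ∑ p : ι × ι, K p.1 p.2 := fun k i j =>
    (hK i j k).trans (Finset.single_le_sum (f := fun p : ι × ι => K p.1 p.2)
      (fun p _ => (norm_nonneg _).trans (hK p.1 p.2 0)) (Finset.mem_univ (i, j)))
  set c : ℝ := Fintype.card ι * ∑ p : ι × ι, K p.1 p.2
  choose l₁ l₂ r hl₂ hl hr hchar using hM
  have hl₁ : ∀ k, l₁ k ≤ c := fun k => by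
    have h1 : (M k).charpoly.IsRoot (l₁ k : ℂ) := by simp [hchar k]
    have h2 := norm_le_of_isRoot_charpoly (hK' k) h1
    rw [Complex.norm_real] at h2
    exact (le_abs_self _).trans h2
  have hcomp : IsCompact (Set.Icc (0 : ℝ) c ×ˢ Set.Icc (0 : ℝ) c ×ˢ
      Metric.closedBall (0 : Fin m → ℂ) c) :=
    isCompact_Icc.prod (isCompact_Icc.prod (isCompact_closedBall _ _))
  obtain ⟨⟨a, b, s⟩, -, φ, hφ, hlimφ⟩ := hcomp.tendsto_subseq
    (x := fun k => (l₁ k, l₂ k, r k)) fun k => by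
      have h0 : 0 ≤ l₁ k := (hl₂ k).trans (hl k)
      refine ⟨⟨h0, hl₁ k⟩, ⟨hl₂ k, (hl k).trans (hl₁ k)⟩, ?_⟩
      rw [mem_closedBall_zero_iff, pi_norm_le_iff_of_nonneg (h0.trans (hl₁ k))]
      exact fun i => (hr k i).trans ((hl k).trans (hl₁ k))
  have ha : Tendsto (fun k => l₁ (φ k)) atTop (𝓝 a) := hlimφ.fst_nhds
  have hb : Tendsto (fun k => l₂ (φ k)) atTop (𝓝 b) := hlimφ.snd_nhds.fst_nhds
  have hs : ∀ i, Tendsto (fun k => r (φ k) i) atTop (𝓝 (s i)) :=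
    tendsto_pi_nhds.1 hlimφ.snd_nhds.snd_nhds
  refine ⟨a, b, s, ge_of_tendsto' hb fun k => hl₂ _, le_of_tendsto_of_tendsto' hb ha fun k => hl _,
    fun i => le_of_tendsto_of_tendsto' (hs i).norm hb fun k => hr _ i, ?_⟩
  refine Polynomial.funext fun w => ?_
  have h1 : Tendsto (fun k => (M (φ k)).charpoly.eval w) atTop (𝓝 (M₀.charpoly.eval w)) := by
    simp only [Matrix.eval_charpoly]
    have hc : Continuous fun N : Matrix ι ι ℂ => (Matrix.scalar ι w - N).det :=
      Continuous.matrix_det (by fun_prop)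
    exact (hc.tendsto M₀).comp (hlim.comp hφ.tendsto_atTop)
  refine tendsto_nhds_unique h1 ?_
  simp only [hchar, Polynomial.eval_mul, Polynomial.eval_prod, Polynomial.eval_sub,
    Polynomial.eval_X, Polynomial.eval_C]
  exact (tendsto_const_nhds.sub ((Complex.continuous_ofReal.tendsto a).comp ha)).mul
    ((tendsto_const_nhds.sub ((Complex.continuous_ofReal.tendsto b).comp hb)).mul
      (tendsto_finsetProd _ fun i _ => tendsto_const_nhds.sub (hs i)))

/-! ### Approximation by matrices with positive diagonal -/

/-- The matrix with entries `t ^ |e i - e j|`. For `0 < t ≤ 1` it is positive and its minors of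
order two are nonnegative; it tends to the identity matrix as `t → 0`. -/
noncomputable def distPowMatrix {ι : Type*} (e : ι → ℕ) (t : ℝ) : Matrix ι ι ℝ :=
  Matrix.of fun i j => t ^ ((e i : ℤ) - e j).natAbs

theorem hasNonnegMinorsTwo_distPowMatrix {ι : Type*} (e : ι → ℕ) {t : ℝ} (h0 : 0 ≤ t)
    (h1 : t ≤ 1) : HasNonnegMinorsTwo e (distPowMatrix e t) := by
  intro i j k l hij hkl
  simp only [distPowMatrix, Matrix.of_apply, ← pow_add]
  -- For exponents this is `|a - c| + |b - d| ≤ |a - d| + |b - c|` when `a < b` and `c < d`.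
  exact pow_le_pow_of_le_one h0 h1 (by omega)

theorem tendsto_distPowMatrix {ι : Type*} [DecidableEq ι] {e : ι → ℕ}
    (he : Function.Injective e) : Tendsto (distPowMatrix e) (𝓝 0) (𝓝 1) := by
  refine tendsto_pi_nhds.2 fun i => tendsto_pi_nhds.2 fun j => ?_
  have hc : Continuous fun t : ℝ => t ^ ((e i : ℤ) - e j).natAbs := by fun_prop
  have h := hc.tendsto 0
  have h2 : (0 : ℝ) ^ ((e i : ℤ) - e j).natAbs = (1 : Matrix ι ι ℝ) i j := by
    by_cases hij : i = j
    · subst hij; simp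
    · rw [Matrix.one_apply_ne hij, zero_pow]
      have := he.ne hij
      omega
  rw [h2] at h
  exact h

theorem HasNonnegMinorsTwo.hasDominantNonnegPair {m : ℕ} {e : Fin (m + 2) → ℕ}
    (he : Function.Injective e) {B : Matrix (Fin (m + 2)) (Fin (m + 2)) ℝ}
    (hB2 : HasNonnegMinorsTwo e B) (hB : ∀ i j, 0 ≤ B i j) :
    HasDominantNonnegPair m (B.map Complex.ofReal) := by
  -- For `B = 0` the products `F * B * F` vanish; otherwise one nonzero entry of `B` makes all their
  -- entries positive.
  by_cases hB0 : B = 0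
  · refine ⟨0, 0, 0, le_rfl, le_rfl, by simp, ?_⟩
    have : B.map Complex.ofReal = 0 := by rw [hB0]; ext; simp
    rw [this, Matrix.charpoly_zero]
    simp
    ring
  obtain ⟨p, q, hpq⟩ : ∃ p q, B p q ≠ 0 := by
    by_contra! h
    exact hB0 (Matrix.ext h)
  set t : ℕ → ℝ := fun k => 1 / ((k : ℝ) + 1)
  have ht0 : ∀ k, 0 < t k := fun k => Nat.one_div_pos_of_nat
  have ht1 : ∀ k, t k ≤ 1 := fun k => by
    rw [div_le_one (by positivity)]; linarith [Nat.cast_nonneg (α := ℝ) k]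
  have hF0 : ∀ k i j, 0 < distPowMatrix e (t k) i j := fun k i j => pow_pos (ht0 k) _
  have hF2 := fun k => hasNonnegMinorsTwo_distPowMatrix e (ht0 k).le (ht1 k)
  have hF : Tendsto (fun k => distPowMatrix e (t k)) atTop (𝓝 1) :=
    (tendsto_distPowMatrix he).comp tendsto_one_div_add_atTop_nhds_zero_nat
  have hlim : Tendsto (fun k => distPowMatrix e (t k) * B * distPowMatrix e (t k)) atTop (𝓝 B) := by
    have := (hF.mul (tendsto_const_nhds (x := B))).mul hF
    simpa using this
  have hmap : Continuous fun N : Matrix (Fin (m + 2)) (Fin (m + 2)) ℝ => N.map Complex.ofReal :=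
    Continuous.matrix_map continuous_id Complex.continuous_ofReal
  refine HasDominantNonnegPair.of_tendsto ((hmap.tendsto B).comp hlim) fun k => ?_
  have hFB := Matrix.mul_nonneg_entries (fun i j => (hF0 k i j).le) hB
  refine (((hF2 k).mul he hB2).mul he (hF2 k)).hasDominantNonnegPair_of_pos_diag he
    (Matrix.mul_nonneg_entries hFB fun i j => (hF0 k i j).le) fun i => ?_
  refine Finset.sum_pos' (fun j _ => mul_nonneg (hFB i j) (hF0 k j i).le)
    ⟨q, Finset.mem_univ q, mul_pos ?_ (hF0 k q i)⟩
  exact Finset.sum_pos' (fun j _ => mul_nonneg (hF0 k i j).le (hB j q))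
    ⟨p, Finset.mem_univ p, mul_pos (hF0 k i p) (lt_of_le_of_ne (hB p q) hpq.symm)⟩

/-! ### The linear order and the signs -/

/-- A linear order given by a transitive set is induced by an injective numbering. -/
theorem IsTransitiveSet.exists_rank {n : ℕ} {W : Set (Fin n × Fin n)} (hW : IsTransitiveSet W) :
    ∃ e : Fin n → ℕ, Function.Injective e ∧ ∀ i j, e i < e j → i ≠ j ∧ (i, j) ∈ W := by
  classical
  have htot : ∀ i j, (i, j) ∈ W ∨ (j, i) ∈ W := fun i j => by
    have : (i, j) ∈ W ∪ {p | (p.2, p.1) ∈ W} := by rw [hW.union_swap]; trivial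
    exact this
  have hanti : ∀ i j, (i, j) ∈ W → (j, i) ∈ W → i = j := fun i j h1 h2 => by
    have : (i, j) ∈ W ∩ {p | (p.2, p.1) ∈ W} := ⟨h1, h2⟩
    rw [hW.inter_swap] at this
    exact this
  -- The rank of `i` is the number of its predecessors, itself included.
  set S : Fin n → Finset (Fin n) := fun i => Finset.univ.filter fun k => (k, i) ∈ W with hS
  have hsub : ∀ i j, (i, j) ∈ W → S i ⊆ S j := fun i j hij k hk => by
    simp only [hS, Finset.mem_filter, Finset.mem_univ, true_and] at hk ⊢
    exact hW.trans k i j hk hij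
  have heq : ∀ i j, (i, j) ∈ W → (S i).card = (S j).card → i = j := fun i j hij hc => by
    have h1 := Finset.eq_of_subset_of_card_le (hsub i j hij) hc.ge
    have h2 : j ∈ S j := by simpa [hS] using htot j j
    rw [← h1] at h2
    exact hanti i j hij (by simpa [hS] using h2)
  refine ⟨fun i => (S i).card, fun i j hij => ?_, fun i j hij => ⟨?_, ?_⟩⟩
  · rcases htot i j with h | h
    · exact heq i j h hij
    · exact (heq j i h hij.symm).symm
  · rintro rfl; exact lt_irrefl _ hij
  · exact (htot i j).resolve_right fun h => (Finset.card_le_card (hsub j i h)).not_gt hij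

open Classical in
/-- The sign `-1` on `J` and `1` off `J`. -/
noncomputable def indexSign {ι : Type*} (J : Set ι) (i : ι) : ℝ := if i ∈ J then -1 else 1

theorem indexSign_mul_self {ι : Type*} (J : Set ι) (i : ι) :
    indexSign J i * indexSign J i = 1 := by
  unfold indexSign; split_ifs <;> norm_num

theorem indexSign_mul_of_iff {ι : Type*} {J : Set ι} {i j : ι} (h : i ∈ J ↔ j ∈ J) :
    indexSign J i * indexSign J j = 1 := by
  unfold indexSign; by_cases hj : j ∈ J <;> simp [h, hj]

theorem indexSign_mul_of_xor {ι : Type*} {J : Set ι} {i j : ι} (h : Xor (i ∈ J) (j ∈ J)) :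
    indexSign J i * indexSign J j = -1 := by
  unfold indexSign; rcases h with ⟨h1, h2⟩ | ⟨h1, h2⟩ <;> simp [h1, h2]

theorem IsSignSymmetricWith.indexSign_mul_nonneg {ι : Type*} {A : Matrix ι ι ℝ} {J : Set ι}
    (hA : IsSignSymmetricWith A J) (i j : ι) : 0 ≤ indexSign J i * indexSign J j * A i j := by
  by_cases h : Xor (i ∈ J) (j ∈ J)
  · rw [indexSign_mul_of_xor h]; linarith [hA.1 i j h]
  · rw [indexSign_mul_of_iff (by rwa [xor_iff_not_iff, not_not] at h)]
    linarith [not_lt.1 fun h' => h (hA.2 i j h')]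

/-- For `(i, j) ∈ wHat J J'`, the minor on rows `i, j` is, up to a sign fixed by `J` and `J'`,
the minor on the increasing pair formed by `i` and `j`. -/
theorem exists_increasingPair_of_mem_wHat {n : ℕ} {J : Set (Fin n)} {J' : Set (IncreasingPair n)}
    {i j : Fin n} (hne : i ≠ j) (h : (i, j) ∈ wHat J J') :
    ∃ (p : IncreasingPair n) (s : ℝ), indexSign J i * indexSign J j * s = - indexSign J' p ∧
      ∀ a b : Fin n → ℝ, a i * b j - a j * b i = s * (a p.1.1 * b p.1.2 - a p.1.2 * b p.1.1) := by
  rcases h with h | ⟨hlt, hJ, hJ'⟩ | ⟨hlt, hJ, hJ'⟩ | ⟨hlt, hJ, hJ'⟩ | ⟨hlt, hJ, hJ'⟩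
  · exact absurd h hne
  · refine ⟨⟨(i, j), hlt⟩, 1, ?_, fun a b => by ring⟩
    rw [indexSign_mul_of_iff hJ]; simp [indexSign, hJ']
  · refine ⟨⟨(i, j), hlt⟩, 1, ?_, fun a b => by ring⟩
    rw [indexSign_mul_of_xor hJ]; simp [indexSign, hJ']
  · refine ⟨⟨(j, i), hlt⟩, -1, ?_, fun a b => by ring⟩
    rw [indexSign_mul_of_iff hJ]; simp [indexSign, hJ']
  · refine ⟨⟨(j, i), hlt⟩, -1, ?_, fun a b => by ring⟩
    rw [indexSign_mul_of_xor hJ]; simp [indexSign, hJ']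

theorem indexSign_mul_minor_nonneg {n : ℕ} {A : Matrix (Fin n) (Fin n) ℝ} {J : Set (Fin n)}
    {J' : Set (IncreasingPair n)} (hA2 : IsSignSymmetricWith (secondCompound A) J')
    {i j k l : Fin n} (hij : i ≠ j) (hkl : k ≠ l) (hW : (i, j) ∈ wHat J J')
    (hW' : (k, l) ∈ wHat J J') :
    0 ≤ (indexSign J i * indexSign J j) * (indexSign J k * indexSign J l) *
      (A i k * A j l - A i l * A j k) := by
  obtain ⟨p, s, hs, hp⟩ := exists_increasingPair_of_mem_wHat hij hW
  obtain ⟨q, u, hu, hq⟩ := exists_increasingPair_of_mem_wHat hkl hW'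
  have h1 := hp (fun x => A x k) (fun x => A x l)
  have h2 := hq (A p.1.1) (A p.1.2)
  have h3 := hA2.indexSign_mul_nonneg p q
  have h4 : A i k * A j l - A i l * A j k = s * (u * secondCompound A p q) := by
    simp only [secondCompound, Matrix.of_apply]
    linear_combination h1 + s * h2
  have h5 : (indexSign J i * indexSign J j) * (indexSign J k * indexSign J l) *
      (A i k * A j l - A i l * A j k) = indexSign J' p * indexSign J' q * secondCompound A p q := by
    -- The minus signs in `hs` (rows) and `hu` (columns) cancel.
    rw [h4]
    linear_combination (indexSign J k * indexSign J l * u * secondCompound A p q) * hs -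
      (indexSign J' p * secondCompound A p q) * hu
  rw [h5]; exact h3

/-! ### Conclusion -/

theorem HasDominantNonnegPair.exists_complexEigenvalues {n m : ℕ} {A : Matrix (Fin n) (Fin n) ℝ}
    (h : HasDominantNonnegPair m (A.map Complex.ofReal)) :
    ∃ (l₁ l₂ : ℝ) (rest : Multiset ℂ),
      complexEigenvalues A = (l₁ : ℂ) ::ₘ (l₂ : ℂ) ::ₘ rest ∧
      0 ≤ l₂ ∧ l₂ ≤ l₁ ∧ ∀ z ∈ rest, ‖z‖ ≤ l₂ := by
  obtain ⟨l₁, l₂, r, h0, hl, hr, hchar⟩ := h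
  refine ⟨l₁, l₂, Finset.univ.val.map r, ?_, h0, hl, by simpa using hr⟩
  rw [complexEigenvalues, hchar, ← Polynomial.roots_multiset_prod_X_sub_C
    ((l₁ : ℂ) ::ₘ (l₂ : ℂ) ::ₘ Finset.univ.val.map r)]
  rw [Multiset.map_cons, Multiset.map_cons, Multiset.prod_cons, Multiset.prod_cons,
    Multiset.map_map]
  rfl

theorem theorem12 (n : ℕ) (hn : 2 ≤ n) (A : Matrix (Fin n) (Fin n) ℝ)
    (J : Set (Fin n)) (J' : Set (IncreasingPair n))
    (hA : IsSignSymmetricWith A J)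
    (hA2 : IsSignSymmetricWith (secondCompound A) J')
    (hW : IsTransitiveSet (wHat J J')) :
    ∃ (l₁ l₂ : ℝ) (rest : Multiset ℂ),
      complexEigenvalues A = (l₁ : ℂ) ::ₘ (l₂ : ℂ) ::ₘ rest ∧
      0 ≤ l₂ ∧ l₂ ≤ l₁ ∧ ∀ z ∈ rest, ‖z‖ ≤ l₂ := by
  obtain ⟨m, rfl⟩ := Nat.exists_eq_add_of_le' hn
  obtain ⟨e, he, heW⟩ := hW.exists_rank
  set D : Matrix (Fin (m + 2)) (Fin (m + 2)) ℝ := Matrix.diagonal (indexSign J) with hD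
  have hDD : D * D = 1 := by
    rw [hD, Matrix.diagonal_mul_diagonal]; simp [indexSign_mul_self]
  have hB : ∀ i j, (D * A * D) i j = indexSign J i * indexSign J j * A i j := fun i j => by
    rw [hD, Matrix.mul_diagonal, Matrix.diagonal_mul]; ring
  have hB0 : ∀ i j, 0 ≤ (D * A * D) i j := fun i j => by
    rw [hB]; exact hA.indexSign_mul_nonneg i j
  have hB2 : HasNonnegMinorsTwo e (D * A * D) := fun i j k l hij hkl => by
    obtain ⟨h1, h2⟩ := heW i j hij
    obtain ⟨h3, h4⟩ := heW k l hkl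
    simp only [hB]
    linarith [indexSign_mul_minor_nonneg hA2 h1 h3 h2 h4]
  have hchar : (D * A * D).charpoly = A.charpoly := by
    rw [Matrix.charpoly_mul_comm, ← Matrix.mul_assoc, hDD, Matrix.one_mul]
  have hdom := hB2.hasDominantNonnegPair he hB0
  refine HasDominantNonnegPair.exists_complexEigenvalues (m := m) ?_
  have hmap : ∀ N : Matrix (Fin (m + 2)) (Fin (m + 2)) ℝ,
      (N.map Complex.ofReal).charpoly = N.charpoly.map Complex.ofRealHom := fun N =>
    Matrix.charpoly_map N Complex.ofRealHom
  unfold HasDominantNonnegPair at hdom ⊢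
  rwa [hmap, ← hchar, ← hmap]
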